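/- Let $n\ge 1$ and $k\ge 0$ be integers. Consider $n$ men and $n$ women; each participant $x$ has a profile $\mathbf a(x)\in Q_k=\{0,1\}^k$ and a tie-breaking list $T_x$, an ordering of the $n$ members of the opposite side. Participant $x$ ranks the members of the opposite side by the Hamming distance of their profiles from $\mathbf a(x)$, closest first, those at equal distance in the order of $T_x$, and prefers every one of them to being unmatched. A matching pairs some of the men with distinct women and leaves the others unmatched; it is stable if no man and woman both strictly prefer each other to their situation in the matching. A stable partner of $x$ is a partner of $x$ in some stable matching. A stable matching always exists, and the Hamming distance between $x$ and the partner of $x$ is the same in all stable matchings; it is called the matching distance of $x$. All profiles and tie-breaking lists are chosen independently and uniformly at random, and $X$ denotes the matching distance of a participant chosen uniformly at random from all $2n$ participants, independently of the rest. **Theorem.** Let $k(n)$ be a sequence of nonnegative integers. (i) If $k(n)=\Omega(n^3)$ (that is, for some constant $c>0$, $k(n)\ge c\,n^3$ for all large $n$), then for $k=k(n)$ the fraction of the $2n$ participants that have more than one stable partner tends to $0$ in probability as $n\to\infty$: for every $\varepsilon>0$, the probability that it exceeds $\varepsilon$ tends to $0$. (ii) If $k(n)=\Omega(n^6)$, then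 for $k=k(n)$, with probability tending to $1$ as $n\to\infty$, the stable matching is unique without resorting to tie-breaking: the profiles are such that there is a matching $\mu$ which, for every choice of the tie-breaking lists, is the one and only stable matching. (iii) For all $n\ge 1$, $k\ge 0$ and all real $\beta>1$, $$\mathbb P\left(X<\frac k2-\sqrt{\beta k\log n}\right)\le n^{1-\beta},$$ where $\log$ is the natural logarithm. -/

import Mathlib

open Filter Asymptotics
open scoped Topology

namespace ProfileMatching

/-- The participants of a community of `n` men (`Sum.inl`) and `n` women (`Sum.inr`). -/
abbrev User (n : ℕ) : Type := Fin n ⊕ Fin n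

/-- `x` and `y` are on opposite sides of the market. -/
def Opposite {n : ℕ} (x y : User n) : Prop := x.isLeft ≠ y.isLeft

/-- The index of a participant within their own side of the market. -/
def idx {n : ℕ} : User n → Fin n := Sum.elim id id

/-- The profiles of all participants: each of them is a point of the hypercube `Q_k`. -/
abbrev Profiles (n k : ℕ) : Type := User n → Fin k → Bool

/-- The tie-breaking lists of all participants. `T x` is an ordering of the opposite side of `x`:
the member of index `i` has position `T x i` in the list (position `0` is the first one). -/
abbrev TieBreaks (n : ℕ) : Type := User n → Equiv.Perm (Fin n)

/-- An instance of the profile matching problem: profiles together with tie-breaking lists. -/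
abbrev Market (n k : ℕ) : Type := Profiles n k × TieBreaks n

/-- The Hamming distance between the profiles of two participants. -/
def dist {n k : ℕ} (a : Profiles n k) (x y : User n) : ℕ := hammingDist (a x) (a y)

/-- A matching: everybody is matched to somebody of the opposite side or is unmatched
(`partner x = x`), and the partner of the partner of `x` is `x`. -/
@[ext]
structure Matching (n : ℕ) where
  /-- The partner of a participant (the participant themselves if they are unmatched). -/
  partner : User n → User n
  partner_partner : ∀ x, partner (partner x) = x
  self_or_opposite : ∀ x, partner x = x ∨ Opposite x (partner x)

/-- `x` strictly prefers `y` (a member of the opposite side) to `z`, where `z` is either `x`, which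
stands for being unmatched and comes last, or a member of the opposite side. Members of the
opposite side are ranked by distance, and at equal distance by the tie-breaking list of `x`. -/
def Prefers {n k : ℕ} (M : Market n k) (x y z : User n) : Prop :=
  z = x ∨ dist M.1 x y < dist M.1 x z ∨
    (dist M.1 x y = dist M.1 x z ∧ M.2 x (idx y) < M.2 x (idx z))

/-- `x` and `y`, on opposite sides, prefer each other to their partners under `μ`. -/
def Blocking {n k : ℕ} (M : Market n k) (μ : Matching n) (x y : User n) : Prop :=
  Opposite x y ∧ Prefers M x y (μ.partner x) ∧ Prefers M y x (μ.partner y)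

/-- A matching is stable if it has no blocking pair. -/
def Stable {n k : ℕ} (M : Market n k) (μ : Matching n) : Prop :=
  ∀ x y, ¬ Blocking M μ x y

/-- `y` is a stable partner of `x`: they are matched to each other in some stable matching. -/
def StablePartner {n k : ℕ} (M : Market n k) (x y : User n) : Prop :=
  y ≠ x ∧ ∃ μ : Matching n, Stable M μ ∧ μ.partner x = y

/-- The fraction of the `2 n` participants that have more than one stable partner. -/
noncomputable def multipleFraction {n k : ℕ} (M : Market n k) : ℝ :=
  (Set.ncard {x : User n | ∃ y y', y ≠ y' ∧ StablePartner M x y ∧ StablePartner M x y'} : ℝ) /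
    (2 * n)

/-- The stable matching is unique without resorting to tie-breaking: the profiles alone determine
it. That is, there is a matching which is the one and only stable matching whichever
tie-breaking lists are used. -/
def UniqueWithoutTieBreaking {n k : ℕ} (a : Profiles n k) : Prop :=
  ∃ μ : Matching n, ∀ (T : TieBreaks n) (ν : Matching n), Stable (a, T) ν ↔ ν = μ

/-- The matching distance of `x`: the distance between `x` and their partner in a stable matching.
(The infimum over all stable matchings; it is the common value for all of them.) -/
noncomputable def matchingDist {n k : ℕ} (M : Market n k) (x : User n) : ℕ :=
  sInf {d : ℕ | ∃ μ : Matching n, Stable M μ ∧ d = dist M.1 x (μ.partner x)}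

/-- The probability of an event under the uniform distribution on a finite type. For `Market n k`,
a finite product, it says that all the answers are independent fair bits, that all the tie-breaking
lists are uniformly distributed orderings, and that all of these are independent. -/
noncomputable def prob {α : Type} [Fintype α] [Nonempty α] (E : Set α) : ℝ :=
  ((PMF.uniformOfFintype α).toOuterMeasure E).toReal

end ProfileMatching

/-! Distances are symmetric, and this makes them rigid. Compare two matchings without blocking pairs
up to distance `d`. Those who prefer the first (and are matched by it within `d`) are carried by
either partner map bijectively onto those who prefer the second. Both maps preserve distances, so a
double count of the sums of distances turns every weak inequality into an equality: the two
matchings agree on all partner distances up to `d` (`StableBelow.gap_eq`).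

Hence a participant `x` has at most one critical distance in the market restricted to a set `S`, and
it depends on the profiles in `S` only. If a removed participant `y` lies exactly at that distance
from `x`, then, given all other profiles, a Hamming distance to a uniform point takes a prescribed
value, which has probability at most `1 / √(k + 1)`. Two such events in succession, for `y` and for
a second removed participant `z`, have probability at most `1 / (k + 1)`.

Two stable partners of `x` force a double coincidence at `x`. Two different matchings, stable for
possibly different tie-breaking lists, force a single or a double coincidence somewhere. Union
bounds over `O(n ^ 2)` pairs and `O(n ^ 3)` triples give (i) and (ii). Part (iii) is a union bound
over the `n` possible partners combined with Chernoff's inequality. -/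

namespace ProfileMatching

/-! ### Preferences encoded as numerical ranks -/

/-- The distance from `x` to `z`, where being unmatched (`z = x`) counts as distance `k + 1`. -/
def gap {n k : ℕ} (a : Profiles n k) (x z : User n) : ℕ := if z = x then k + 1 else dist a x z

/-- A numerical rank representing the preferences of `x`; smaller is better. -/
def rank {n k : ℕ} (M : Market n k) (x z : User n) : ℕ :=
  gap M.1 x z * n + if z = x then 0 else (M.2 x (idx z)).val

lemma dist_comm {n k : ℕ} (a : Profiles n k) (x y : User n) : dist a x y = dist a y x :=
  hammingDist_comm _ _

lemma dist_le {n k : ℕ} (a : Profiles n k) (x y : User n) : dist a x y ≤ k := by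
  simpa [dist] using hammingDist_le_card_fintype (x := a x) (y := a y)

lemma gap_comm {n k : ℕ} (a : Profiles n k) (x y : User n) : gap a x y = gap a y x := by
  simp only [gap, dist_comm a x y, eq_comm]

lemma gap_of_ne {n k : ℕ} (a : Profiles n k) {x y : User n} (h : y ≠ x) :
    gap a x y = dist a x y := if_neg h

lemma Opposite.symm {n : ℕ} {x y : User n} (h : Opposite x y) : Opposite y x := Ne.symm h

lemma Opposite.ne {n : ℕ} {x y : User n} (h : Opposite x y) : y ≠ x := by
  rintro rfl; exact h rfl

lemma Opposite.eq_of_idx {n : ℕ} {x y z : User n} (hy : Opposite x y) (hz : Opposite x z)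
    (h : idx y = idx z) : y = z := by
  rcases x with x | x <;> rcases y with y | y <;> rcases z with z | z <;>
    simp_all [Opposite, idx]

lemma mul_add_lt_mul_add_iff_lex {n p q s t : ℕ} (hs : s < n) (ht : t < n) :
    p * n + s < q * n + t ↔ p < q ∨ (p = q ∧ s < t) := by
  constructor
  · intro h
    rcases lt_trichotomy p q with hpq | hpq | hpq
    · exact Or.inl hpq
    · subst hpq; exact Or.inr ⟨rfl, by omega⟩
    · have : (q + 1) * n ≤ p * n := Nat.mul_le_mul_right n hpq
      rw [Nat.add_mul] at this; omega
  · rintro (h | ⟨rfl, h⟩)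
    · have : (p + 1) * n ≤ q * n := Nat.mul_le_mul_right n h
      rw [Nat.add_mul] at this; omega
    · omega

lemma tie_lt {n k : ℕ} (M : Market n k) (x z : User n) :
    (if z = x then 0 else (M.2 x (idx z)).val) < n := by
  split
  · exact (Nat.zero_le _).trans_lt (idx x).isLt
  · exact (M.2 x (idx z)).isLt

/-- The tie-breaking position is below `n`, so `rank` is lexicographic. Being unmatched has gap `k +
1`, beyond every distance, hence comes last whatever its tie term. -/
lemma prefers_iff {n k : ℕ} (M : Market n k) {x y z : User n} (hy : y ≠ x) :
    Prefers M x y z ↔ rank M x y < rank M x z := by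
  rw [rank, rank, mul_add_lt_mul_add_iff_lex (tie_lt M x y) (tie_lt M x z), Prefers]
  have := dist_le M.1 x y
  by_cases hz : z = x
  · simp only [gap, hz, hy, if_true, if_false, true_or, true_iff]; left; omega
  · simp [gap, hz, hy]

lemma gap_le_of_rank_le {n k : ℕ} (M : Market n k) {x y z : User n}
    (h : rank M x y ≤ rank M x z) : gap M.1 x y ≤ gap M.1 x z := by
  by_contra! hlt
  exact absurd h (not_le.2 ((mul_add_lt_mul_add_iff_lex (tie_lt M x z) (tie_lt M x y)).2
    (Or.inl hlt)))

lemma rank_inj {n k : ℕ} (M : Market n k) {x y z : User n} (hy : y = x ∨ Opposite x y)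
    (hz : z = x ∨ Opposite x z) (h : rank M x y = rank M x z) : y = z := by
  have key : ∀ {u v : User n}, u = x → Opposite x v → rank M x v < rank M x u := by
    intro u v hu hv
    exact (prefers_iff M hv.ne).1 (Or.inl hu)
  rcases hy with hy | hy <;> rcases hz with hz | hz
  · rw [hy, hz]
  · have := key hy hz; omega
  · have := key hz hy; omega
  · have hg := le_antisymm (gap_le_of_rank_le M h.le) (gap_le_of_rank_le M h.ge)
    rw [rank, rank, hg, if_neg hy.ne, if_neg hz.ne] at h
    have : M.2 x (idx y) = M.2 x (idx z) := Fin.ext (by omega)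
    exact hy.eq_of_idx hz ((M.2 x).injective this)

/-! ### Operations on matchings -/

namespace Matching

variable {n : ℕ} (μ : Matching n)

lemma partner_injective : Function.Injective μ.partner :=
  Function.LeftInverse.injective μ.partner_partner

lemma opposite {x : User n} (h : μ.partner x ≠ x) : Opposite x (μ.partner x) :=
  (μ.self_or_opposite x).resolve_left h

lemma partner_partner_ne {x : User n} (h : μ.partner x ≠ x) :
    μ.partner (μ.partner x) ≠ μ.partner x := by
  rw [μ.partner_partner]; exact h.symm

/-- The matching obtained by separating `y` from their partner. -/
def separate (y : User n) : Matching n where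
  partner x := if x = y ∨ x = μ.partner y then x else μ.partner x
  partner_partner x := by
    by_cases h : x = y ∨ x = μ.partner y
    · simp [h]
    · have : ¬ (μ.partner x = y ∨ μ.partner x = μ.partner y) := by
        rintro (h' | h')
        · exact h (Or.inr (by rw [← h', μ.partner_partner]))
        · exact h (Or.inl (μ.partner_injective h'))
      simp only [h, this, if_false, μ.partner_partner]
  self_or_opposite x := by
    split
    · exact Or.inl rfl
    · exact μ.self_or_opposite x

lemma separate_partner_of_ne {x y : User n} (h : x ≠ y) (h' : x ≠ μ.partner y) :
    (μ.separate y).partner x = μ.partner x := by simp [separate, h, h']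

lemma separate_partner_left (y : User n) : (μ.separate y).partner y = y := by simp [separate]

lemma gap_partner {k : ℕ} (a : Profiles n k) (x : User n) :
    gap a (μ.partner x) (μ.partner (μ.partner x)) = gap a x (μ.partner x) := by
  rw [μ.partner_partner, gap_comm]

end Matching

/-! ### Rigidity of partner distances -/

/-- `μ` is a matching of the participants in `S` for which every blocking pair within `S` is at
distance more than `d`. -/
def StableBelow {n k : ℕ} (M : Market n k) (S : Set (User n)) (d : ℕ) (μ : Matching n) : Prop :=
  (∀ x, x ∉ S → μ.partner x = x) ∧
    ∀ x ∈ S, ∀ y ∈ S, Blocking M μ x y → d < dist M.1 x y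

lemma Stable.stableBelow {n k : ℕ} {M : Market n k} {μ : Matching n} (h : Stable M μ) (d : ℕ) :
    StableBelow M Set.univ d μ :=
  ⟨fun x hx => absurd (Set.mem_univ x) hx, fun x _ y _ hb => absurd hb (h x y)⟩

lemma StableBelow.mono {n k : ℕ} {M : Market n k} {S : Set (User n)} {d e : ℕ} {μ : Matching n}
    (h : StableBelow M S e μ) (hde : d ≤ e) : StableBelow M S d μ :=
  ⟨h.1, fun x hx y hy hb => hde.trans_lt (h.2 x hx y hy hb)⟩

lemma StableBelow.mem {n k : ℕ} {M : Market n k} {S : Set (User n)} {d : ℕ} {μ : Matching n}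
    (h : StableBelow M S d μ) {x : User n} (hx : μ.partner x ≠ x) : x ∈ S := by
  by_contra hS; exact hx (h.1 x hS)

/-- If `x` strictly prefers the partner under `μ` to the one under `ν`, the opinion of the partner
is the opposite. -/
lemma StableBelow.rank_lt_of_rank_lt {n k : ℕ} {M : Market n k} {S : Set (User n)} {d : ℕ}
    {μ ν : Matching n} (hμ : StableBelow M S d μ) (hν : StableBelow M S d ν) {x : User n}
    (hx : μ.partner x ≠ x) (hd : dist M.1 x (μ.partner x) ≤ d)
    (hp : rank M x (μ.partner x) < rank M x (ν.partner x)) :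
    rank M (μ.partner x) (ν.partner (μ.partner x)) <
      rank M (μ.partner x) (μ.partner (μ.partner x)) := by
  set y := μ.partner x with hy
  have hopp : Opposite x y := μ.opposite hx
  have hyy : μ.partner y = x := by rw [hy, μ.partner_partner]
  have hyS : y ∈ S := hμ.mem (by rw [hyy]; exact hx.symm)
  -- Otherwise `x` and `y` would block `ν` inside `S` at distance at most `d`.
  have hnb : ¬ Prefers M y x (ν.partner y) := fun h =>
    absurd (hν.2 x (hμ.mem hx) y hyS ⟨hopp, (prefers_iff M hx).2 hp, h⟩) (not_lt.2 hd)
  rw [prefers_iff M hopp.symm.ne, not_lt] at hnb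
  rw [hyy]
  refine lt_of_le_of_ne hnb fun heq => ?_
  have := rank_inj M (ν.self_or_opposite y) (Or.inr hopp.symm) heq
  rw [← this, ν.partner_partner, this] at hp
  exact lt_irrefl _ hp

/-- Participants who are matched within distance `d` by `μ` and prefer it to `ν`. -/
noncomputable def winners {n k : ℕ} (M : Market n k) (d : ℕ) (μ ν : Matching n) :
    Finset (User n) :=
  open Classical in
  {x | μ.partner x ≠ x ∧ dist M.1 x (μ.partner x) ≤ d ∧
    rank M x (μ.partner x) < rank M x (ν.partner x)}

lemma mem_winners {n k : ℕ} {M : Market n k} {d : ℕ} {μ ν : Matching n} {x : User n} :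
    x ∈ winners M d μ ν ↔ μ.partner x ≠ x ∧ dist M.1 x (μ.partner x) ≤ d ∧
      rank M x (μ.partner x) < rank M x (ν.partner x) := by simp [winners]

lemma StableBelow.image_winners_subset {n k : ℕ} {M : Market n k} {S : Set (User n)} {d : ℕ}
    {μ ν : Matching n} (hμ : StableBelow M S d μ) (hν : StableBelow M S d ν) :
    (winners M d μ ν).image μ.partner ⊆ winners M d ν μ := by
  intro y hy
  obtain ⟨x, hx, rfl⟩ := Finset.mem_image.1 hy
  obtain ⟨h1, h2, h3⟩ := mem_winners.1 hx
  have hlt := hμ.rank_lt_of_rank_lt hν h1 h2 h3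
  have hgap := gap_le_of_rank_le M hlt.le
  rw [μ.gap_partner, gap_of_ne _ h1] at hgap
  have hne : ν.partner (μ.partner x) ≠ μ.partner x := by
    intro h
    rw [h, gap, if_pos rfl] at hgap
    have := dist_le M.1 x (μ.partner x)
    omega
  rw [gap_of_ne _ hne] at hgap
  exact mem_winners.2 ⟨hne, hgap.trans h2, hlt⟩

/-- Both partner maps are injective and each sends one set of winners into the other, so the two
cardinalities agree and the inclusion is an equality. -/
lemma StableBelow.image_winners {n k : ℕ} {M : Market n k} {S : Set (User n)} {d : ℕ}
    {μ ν : Matching n} (hμ : StableBelow M S d μ) (hν : StableBelow M S d ν) :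
    (winners M d μ ν).image μ.partner = winners M d ν μ := by
  refine Finset.eq_of_subset_of_card_le (hμ.image_winners_subset hν) ?_
  rw [Finset.card_image_of_injective _ μ.partner_injective,
    ← Finset.card_image_of_injective (winners M d ν μ) ν.partner_injective]
  exact Finset.card_le_card (hν.image_winners_subset hμ)

lemma StableBelow.sum_gap_winners {n k : ℕ} {M : Market n k} {S : Set (User n)} {d : ℕ}
    {μ ν : Matching n} (hμ : StableBelow M S d μ) (hν : StableBelow M S d ν) :
    ∑ x ∈ winners M d ν μ, gap M.1 x (μ.partner x) =
      ∑ x ∈ winners M d μ ν, gap M.1 x (μ.partner x) := by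
  rw [← hμ.image_winners hν, Finset.sum_image fun x _ y _ h => μ.partner_injective h]
  exact Finset.sum_congr rfl fun x _ => μ.gap_partner M.1 x

/-- Winners have weakly smaller gaps under the matching they prefer. Transporting the sums along the
partner maps yields the opposite inequality between the totals, so equality holds term by term. -/
lemma StableBelow.gap_eq_of_mem_winners {n k : ℕ} {M : Market n k} {S : Set (User n)} {d : ℕ}
    {μ ν : Matching n} (hμ : StableBelow M S d μ) (hν : StableBelow M S d ν) {x : User n}
    (hx : x ∈ winners M d μ ν) : gap M.1 x (μ.partner x) = gap M.1 x (ν.partner x) := by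
  have hle : ∀ {μ ν : Matching n}, ∀ x ∈ winners M d μ ν,
      gap M.1 x (μ.partner x) ≤ gap M.1 x (ν.partner x) :=
    fun x hx => gap_le_of_rank_le M (mem_winners.1 hx).2.2.le
  refine (Finset.sum_eq_sum_iff_of_le hle).1 (le_antisymm (Finset.sum_le_sum hle) ?_) x hx
  rw [← hμ.sum_gap_winners hν, hν.sum_gap_winners hμ]
  exact Finset.sum_le_sum hle

/-- Two matchings without blocking pairs at distance at most `d` agree on the distances up to `d`
between partners. -/
lemma StableBelow.gap_eq {n k : ℕ} {M : Market n k} {S : Set (User n)} {d : ℕ}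
    {μ ν : Matching n} (hμ : StableBelow M S d μ) (hν : StableBelow M S d ν) {x : User n}
    (hx : μ.partner x ≠ x) (hd : dist M.1 x (μ.partner x) ≤ d) :
    gap M.1 x (ν.partner x) = dist M.1 x (μ.partner x) := by
  rw [← gap_of_ne _ hx]
  rcases lt_trichotomy (rank M x (μ.partner x)) (rank M x (ν.partner x)) with h | h | h
  · exact (hμ.gap_eq_of_mem_winners hν (mem_winners.2 ⟨hx, hd, h⟩)).symm
  · rw [rank_inj M (μ.self_or_opposite x) (ν.self_or_opposite x) h]
  · have hg := gap_le_of_rank_le M h.le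
    rw [gap_of_ne _ hx] at hg
    have hne : ν.partner x ≠ x := by
      intro h
      rw [h, gap, if_pos rfl] at hg
      have := dist_le M.1 x (μ.partner x)
      omega
    rw [gap_of_ne _ hne] at hg
    exact hν.gap_eq_of_mem_winners hμ (mem_winners.2 ⟨hne, hg.trans hd, h⟩)

lemma partner_ne_of_gap_le {n k : ℕ} {a : Profiles n k} {x y : User n} (h : gap a x y ≤ k) :
    y ≠ x := by
  rintro rfl
  rw [gap, if_pos rfl] at h
  omega

lemma Stable.partner_ne_and_dist_eq {n k : ℕ} {M : Market n k} {μ ν : Matching n}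
    (hμ : Stable M μ) (hν : Stable M ν) {x : User n} (hx : μ.partner x ≠ x) :
    ν.partner x ≠ x ∧ dist M.1 x (ν.partner x) = dist M.1 x (μ.partner x) := by
  have h := (hμ.stableBelow k).gap_eq (hν.stableBelow k) hx (dist_le _ _ _)
  have hne := partner_ne_of_gap_le (h.trans_le (dist_le _ _ _))
  exact ⟨hne, by rw [← h, gap_of_ne _ hne]⟩

lemma Stable.dist_eq {n k : ℕ} {M : Market n k} {μ ν : Matching n}
    (hμ : Stable M μ) (hν : Stable M ν) (x : User n) :
    dist M.1 x (ν.partner x) = dist M.1 x (μ.partner x) := by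
  by_cases hx : μ.partner x = x
  · by_cases hx' : ν.partner x = x
    · rw [hx, hx']
    · exact absurd hx (hν.partner_ne_and_dist_eq hμ hx').1
  · exact (hμ.partner_ne_and_dist_eq hν hx).2

/-- The infimum is over a singleton, so its default value on the empty set plays no role. -/
lemma Stable.dist_eq_matchingDist {n k : ℕ} {M : Market n k} {μ : Matching n}
    (hμ : Stable M μ) (x : User n) : dist M.1 x (μ.partner x) = matchingDist M x := by
  have : {d : ℕ | ∃ ν : Matching n, Stable M ν ∧ d = dist M.1 x (ν.partner x)} =
      {dist M.1 x (μ.partner x)} := by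
    ext d
    constructor
    · rintro ⟨ν, hν, rfl⟩
      exact hμ.dist_eq hν x
    · rintro rfl
      exact ⟨μ, hμ, rfl⟩
  rw [matchingDist, this, csInf_singleton]

/-! ### Perfectness and existence of stable matchings -/

/-- The participant of index `i` on the side opposite to `x`. -/
def across {n : ℕ} (x : User n) (i : Fin n) : User n :=
  Sum.elim (fun _ => Sum.inr i) (fun _ => Sum.inl i) x

lemma opposite_across {n : ℕ} (x : User n) (i : Fin n) : Opposite x (across x i) := by
  rcases x with x | x <;> simp [across, Opposite]

lemma Opposite.across_idx {n : ℕ} {x y : User n} (h : Opposite x y) : across x (idx y) = y := by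
  rcases x with x | x <;> rcases y with y | y <;> simp_all [Opposite, across, idx]

/-- In a stable matching of a balanced market everybody is matched. -/
lemma Stable.partner_ne {n k : ℕ} {M : Market n k} {μ : Matching n} (hμ : Stable M μ)
    (x : User n) : μ.partner x ≠ x := by
  intro hx
  have hall : ∀ y, Opposite x y → μ.partner y ≠ y := fun y hy hyy =>
    hμ x y ⟨hy, Or.inl hx, Or.inl hyy⟩
  have hval : ∀ y, Opposite x y → Opposite y (μ.partner y) := fun y hy => μ.opposite (hall y hy)
  have hf : ∀ i, Opposite x (across x i) := opposite_across x
  -- All `n` members of the side opposite to `x` are matched, injectively, into the side of `x`; by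
  -- finiteness they exhaust it, so `x` is matched after all.
  have hinj : Function.Injective fun i => idx (μ.partner (across x i)) := by
    intro i j hij
    have h1 : Opposite (across x i) (μ.partner (across x j)) := by
      have := hval _ (hf j)
      have h2 := hf i
      have h3 := hf j
      simp only [Opposite] at *
      grind
    have h4 := μ.partner_injective ((hval _ (hf i)).eq_of_idx h1 hij)
    rcases x with x | x <;> simpa [across] using h4
  obtain ⟨i, hi⟩ := (Finite.injective_iff_surjective.1 hinj) (idx x)
  have : μ.partner (across x i) = x := (hval _ (hf i)).eq_of_idx (hf i).symm hi
  have h := congrArg μ.partner this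
  rw [μ.partner_partner, hx] at h
  exact (hf i).ne h

/-- The elements of `X` for which `X` contains a better one in the same fibre of `p`. -/
def rejected {α β : Type*} (p : α → β) (r : α → ℕ) (X : Set α) : Set α :=
  {e | e ∈ X ∧ ∃ e' ∈ X, p e' = p e ∧ r e' < r e}

lemma rejected_mono {α β : Type*} (p : α → β) (r : α → ℕ) : Monotone (rejected p r) :=
  fun _ _ h _ ⟨he, e', he', hp⟩ => ⟨h he, e', h he', hp⟩

lemma exists_best_of_mem_rejected {α β : Type*} {p : α → β} {r : α → ℕ} {X : Set α} {e : α}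
    (he : e ∈ rejected p r X) : ∃ f ∈ X \ rejected p r X, p f = p e ∧ r f < r e := by
  obtain ⟨-, e', he', hp, hr⟩ := he
  obtain ⟨f, ⟨hfX, hfp⟩, hf⟩ := (measure r).wf.has_min {f | f ∈ X ∧ p f = p e} ⟨e', he', hp⟩
  refine ⟨f, ⟨hfX, ?_⟩, hfp, (not_lt.1 (hf e' ⟨he', hp⟩)).trans_lt hr⟩
  rintro ⟨-, g, hg, hgp, hlt⟩
  exact hf g ⟨hg, hgp.trans hfp⟩ hlt

/-- Stable sets of pairs exist for arbitrary strict preferences on the two sides. -/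
lemma exists_stable_set {α β γ : Type*} (p : α → β) (q : α → γ) (r s : α → ℕ) :
    ∃ Z : Set α, (∀ e ∈ Z, ∀ f ∈ Z, p e = p f → r e = r f) ∧
      (∀ e ∈ Z, ∀ f ∈ Z, q e = q f → s e = s f) ∧
      ∀ e, e ∉ Z → (∃ f ∈ Z, p f = p e ∧ r f < r e) ∨ ∃ f ∈ Z, q f = q e ∧ s f < s e := by
  -- Composition of two antitone maps: `X` goes to the pairs that the `p`-side does not reject from
  -- `X`, and those to the pairs that the `q`-side does not reject from them. At a Knaster–Tarski
  -- fixed point the stable set is the intersection of the two sets of pairs.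
  let F : Set α →o Set α :=
    ⟨fun X => (rejected q s (rejected p r X)ᶜ)ᶜ, fun _ _ h =>
      Set.compl_subset_compl.2 (rejected_mono q s
        (Set.compl_subset_compl.2 (rejected_mono p r h)))⟩
  obtain ⟨X, hX⟩ : ∃ X, F X = X := ⟨F.lfp, F.map_lfp⟩
  change (rejected q s (rejected p r X)ᶜ)ᶜ = X at hX
  generalize hY : (rejected p r X)ᶜ = Y at hX
  have hZ : X \ rejected p r X = Y \ rejected q s Y := by
    rw [Set.sdiff_eq, Set.sdiff_eq, hY, hX, Set.inter_comm]
  refine ⟨X \ rejected p r X, ?_, ?_, ?_⟩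
  · intro e he f hf hef
    by_contra hne
    rcases lt_or_gt_of_ne hne with h | h
    · exact hf.2 ⟨hf.1, e, he.1, hef, h⟩
    · exact he.2 ⟨he.1, f, hf.1, hef.symm, h⟩
  · rw [hZ]
    intro e he f hf hef
    by_contra hne
    rcases lt_or_gt_of_ne hne with h | h
    · exact hf.2 ⟨hf.1, e, he.1, hef, h⟩
    · exact he.2 ⟨he.1, f, hf.1, hef.symm, h⟩
  · intro e he
    by_cases h : e ∈ rejected p r X
    · exact Or.inl (exists_best_of_mem_rejected h)
    · have heX : e ∉ X := fun heX => he ⟨heX, h⟩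
      rw [← hX, Set.notMem_compl_iff] at heX
      rw [hZ]
      exact Or.inr (exists_best_of_mem_rejected heX)

theorem exists_stable {n k : ℕ} (M : Market n k) : ∃ μ : Matching n, Stable M μ := by
  classical
  obtain ⟨Z, hZp, hZq, hZ⟩ := exists_stable_set (α := Fin n × Fin n) Prod.fst Prod.snd
    (fun e => rank M (Sum.inl e.1) (Sum.inr e.2)) (fun e => rank M (Sum.inr e.2) (Sum.inl e.1))
  have hp : ∀ {i j j'}, (i, j) ∈ Z → (i, j') ∈ Z → j = j' := fun {i j j'} h h' =>
    Sum.inr_injective (rank_inj M (Or.inr (by simp [Opposite])) (Or.inr (by simp [Opposite]))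
      (hZp _ h _ h' rfl))
  have hq : ∀ {i i' j}, (i, j) ∈ Z → (i', j) ∈ Z → i = i' := fun {i i' j} h h' =>
    Sum.inl_injective (rank_inj M (Or.inr (by simp [Opposite])) (Or.inr (by simp [Opposite]))
      (hZq _ h _ h' rfl))
  let f : User n → User n := fun x => Sum.elim
    (fun i => if h : ∃ j, (i, j) ∈ Z then Sum.inr h.choose else Sum.inl i)
    (fun j => if h : ∃ i, (i, j) ∈ Z then Sum.inl h.choose else Sum.inr j) x
  have hfl : ∀ {i j}, (i, j) ∈ Z → f (Sum.inl i) = Sum.inr j := fun {i j} h => by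
    have hex : ∃ j, (i, j) ∈ Z := ⟨j, h⟩
    simp only [f, Sum.elim_inl, dif_pos hex, hp hex.choose_spec h]
  have hfr : ∀ {i j}, (i, j) ∈ Z → f (Sum.inr j) = Sum.inl i := fun {i j} h => by
    have hex : ∃ i, (i, j) ∈ Z := ⟨i, h⟩
    simp only [f, Sum.elim_inr, dif_pos hex, hq hex.choose_spec h]
  have hfl' : ∀ {i}, (¬ ∃ j, (i, j) ∈ Z) → f (Sum.inl i) = Sum.inl i := fun h => by
    simp only [f, Sum.elim_inl, dif_neg h]
  have hfr' : ∀ {j}, (¬ ∃ i, (i, j) ∈ Z) → f (Sum.inr j) = Sum.inr j := fun h => by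
    simp only [f, Sum.elim_inr, dif_neg h]
  let μ : Matching n :=
    { partner := f
      partner_partner := by
        rintro (i | j)
        · by_cases h : ∃ j, (i, j) ∈ Z
          · obtain ⟨j, h⟩ := h
            rw [hfl h, hfr h]
          · rw [hfl' h, hfl' h]
        · by_cases h : ∃ i, (i, j) ∈ Z
          · obtain ⟨i, h⟩ := h
            rw [hfr h, hfl h]
          · rw [hfr' h, hfr' h]
      self_or_opposite := by
        rintro (i | j)
        · by_cases h : ∃ j, (i, j) ∈ Z
          · obtain ⟨j, h⟩ := h
            rw [hfl h]; simp [Opposite]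
          · exact Or.inl (hfl' h)
        · by_cases h : ∃ i, (i, j) ∈ Z
          · obtain ⟨i, h⟩ := h
            rw [hfr h]; simp [Opposite]
          · exact Or.inl (hfr' h) }
  have main : ∀ i j, Prefers M (Sum.inl i) (Sum.inr j) (f (Sum.inl i)) →
      Prefers M (Sum.inr j) (Sum.inl i) (f (Sum.inr j)) → False := by
    intro i j h1 h2
    rw [prefers_iff M (by simp)] at h1 h2
    by_cases h : (i, j) ∈ Z
    · rw [hfl h] at h1
      exact lt_irrefl _ h1
    · rcases hZ _ h with ⟨⟨i', j'⟩, he, rfl, hlt⟩ | ⟨⟨i', j'⟩, he, rfl, hlt⟩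
      · rw [hfl he] at h1
        exact lt_asymm h1 hlt
      · rw [hfr he] at h2
        exact lt_asymm h2 hlt
  refine ⟨μ, ?_⟩
  rintro (i | j) (i' | j') ⟨h, h1, h2⟩
  · exact h rfl
  · exact main _ _ h1 h2
  · exact main _ _ h2 h1
  · exact h rfl

/-! ### Critical distances and coincidences -/

/-- Some matching of the participants in `S` is stable below `d` and matches `x` at distance
`d`. -/
def Critical {n k : ℕ} (M : Market n k) (S : Set (User n)) (x : User n) (d : ℕ) : Prop :=
  ∃ μ : Matching n, StableBelow M S d μ ∧ μ.partner x ≠ x ∧ dist M.1 x (μ.partner x) = d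

lemma Critical.mem {n k : ℕ} {M : Market n k} {S : Set (User n)} {x : User n} {d : ℕ}
    (h : Critical M S x d) : x ∈ S := by
  obtain ⟨μ, hμ, hx, -⟩ := h
  exact hμ.mem hx

/-- A witness for the larger level is also stable below the smaller one, where rigidity fixes the
distance at `x`. -/
lemma Critical.le_of_critical {n k : ℕ} {M : Market n k} {S : Set (User n)} {x : User n}
    {d e : ℕ} (hd : Critical M S x d) (he : Critical M S x e) : e ≤ d := by
  by_contra! hlt
  obtain ⟨μ, hμ, hx, rfl⟩ := hd
  obtain ⟨ν, hν, hx', rfl⟩ := he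
  have := hμ.gap_eq (hν.mono hlt.le) hx le_rfl
  rw [gap_of_ne _ hx'] at this
  omega

lemma Critical.unique {n k : ℕ} {M : Market n k} {S : Set (User n)} {x : User n}
    {d e : ℕ} (hd : Critical M S x d) (he : Critical M S x e) : d = e :=
  le_antisymm (he.le_of_critical hd) (hd.le_of_critical he)

/-- This supplies the independence: a critical distance ignores the profiles of the participants
removed from `S`. -/
lemma Critical.congr {n k : ℕ} {a b : Profiles n k} {T : TieBreaks n} {S : Set (User n)}
    (hab : ∀ x ∈ S, a x = b x) {x : User n} {d : ℕ} (h : Critical (a, T) S x d) :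
    Critical (b, T) S x d := by
  obtain ⟨μ, hμ, hx, hd⟩ := h
  have hdist : ∀ {x y}, x ∈ S → y ∈ S → dist a x y = dist b x y := fun hx hy => by
    rw [dist, dist, hab _ hx, hab _ hy]
  have hpart : ∀ {x}, x ∈ S → μ.partner x ∈ S := by
    intro x hx
    by_cases h : μ.partner x = x
    · rwa [h]
    · exact hμ.mem (μ.partner_partner_ne h)
  refine ⟨μ, ⟨hμ.1, ?_⟩, hx, ?_⟩
  · rintro x hx y hy ⟨h1, h2, h3⟩
    change d < dist b x y
    rw [← hdist hx hy]
    refine hμ.2 x hx y hy ⟨h1, ?_, ?_⟩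
    · simpa only [Prefers, hdist hx hy, hdist hx (hpart hx)] using h2
    · simpa only [Prefers, hdist hy hx, hdist hy (hpart hy)] using h3
  · rw [← hd]
    exact (hdist (hμ.mem hx) (hpart (hμ.mem hx))).symm

/-- Removing a whole couple changes nobody else's situation, so no blocking pair appears at any
distance. -/
lemma Stable.separate_stableBelow {n k : ℕ} {M : Market n k} {μ : Matching n} (hμ : Stable M μ)
    (y : User n) (d : ℕ) : StableBelow M {y, μ.partner y}ᶜ d (μ.separate y) := by
  constructor
  · intro x hx
    simp only [Set.mem_compl_iff, not_not, Set.mem_insert_iff, Set.mem_singleton_iff] at hx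
    simp [Matching.separate, hx]
  · intro x hx z hz hb
    simp only [Set.mem_compl_iff, not_or, Set.mem_insert_iff, Set.mem_singleton_iff] at hx hz
    simp only [Blocking, μ.separate_partner_of_ne hx.1 hx.2,
      μ.separate_partner_of_ne hz.1 hz.2] at hb
    exact absurd hb (hμ x z)

lemma Prefers.dist_le {n k : ℕ} {M : Market n k} {x y z : User n} (h : Prefers M x y z)
    (hz : z ≠ x) : dist M.1 x y ≤ dist M.1 x z := by
  rcases h with h | h | h
  · exact absurd h hz
  · exact h.le
  · exact h.1.le

lemma prefers_of_dist_lt {n k : ℕ} {M : Market n k} {x y z : User n}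
    (h : dist M.1 x y < dist M.1 x z) : Prefers M x y z := Or.inr (Or.inl h)

/-- Removing a participant whose matching distance exceeds `d` does not affect stability
below `d`. -/
lemma Stable.separate_stableBelow_of_lt {n k : ℕ} {M : Market n k} {μ : Matching n}
    (hμ : Stable M μ) {y : User n} {d : ℕ} (hd : d < dist M.1 y (μ.partner y)) :
    StableBelow M {y}ᶜ d (μ.separate y) := by
  have key : ∀ x z, x ≠ y → z ≠ y → x = μ.partner y →
      Blocking M (μ.separate y) x z → d < dist M.1 x z := by
    rintro x z hxy hzy rfl ⟨h1, -, h3⟩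
    -- The former partner of `y` is farther than `d` from `y`, so it would have preferred `z`
    -- already under `μ`.
    by_contra! hle
    rw [μ.separate_partner_of_ne hzy h1.ne] at h3
    refine hμ _ z ⟨h1, prefers_of_dist_lt ?_, h3⟩
    rw [μ.partner_partner, dist_comm _ _ y]
    omega
  constructor
  · intro x hx
    simp only [Set.mem_compl_iff, not_not, Set.mem_singleton_iff] at hx
    rw [hx, μ.separate_partner_left]
  · intro x hx z hz hb
    simp only [Set.mem_compl_iff, Set.mem_singleton_iff] at hx hz
    by_cases hx' : x = μ.partner y
    · exact key x z hx hz hx' hb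
    by_cases hz' : z = μ.partner y
    · rw [dist_comm]
      exact key z x hz hx hz' ⟨hb.1.symm, hb.2.2, hb.2.1⟩
    · simp only [Blocking, μ.separate_partner_of_ne hx hx', μ.separate_partner_of_ne hz hz'] at hb
      exact absurd hb (hμ x z)

/-- The distance between `x` and `y` is the matching distance of `x` in the market without `y`. -/
def Coincidence {n k : ℕ} (M : Market n k) (x y : User n) : Prop :=
  Critical M {y}ᶜ x (dist M.1 x y)

/-- The distances from `y` to `x` and `z` are both the matching distance of `x` in the market
without `y` and `z`. -/
def DoubleCoincidence {n k : ℕ} (M : Market n k) (x y z : User n) : Prop :=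
  Critical M {y, z}ᶜ x (dist M.1 x y) ∧ z ≠ y ∧ dist M.1 z y = dist M.1 x y

lemma Stable.doubleCoincidence {n k : ℕ} {M : Market n k} {μ : Matching n}
    (hμ : Stable M μ) {x y : User n} (hxy : x ≠ y) (hy : μ.partner x ≠ y)
    (h1 : dist M.1 x y = dist M.1 x (μ.partner x))
    (h2 : dist M.1 (μ.partner y) y = dist M.1 x y) :
    DoubleCoincidence M x y (μ.partner y) := by
  have hx : (μ.separate y).partner x = μ.partner x := by
    refine μ.separate_partner_of_ne hxy ?_
    rintro rfl
    exact hy (μ.partner_partner y)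
  refine ⟨⟨μ.separate y, hμ.separate_stableBelow y _, ?_, ?_⟩, hμ.partner_ne y, h2⟩
  · rw [hx]; exact hμ.partner_ne x
  · rw [hx, h1]

lemma Stable.coincidence {n k : ℕ} {M : Market n k} {μ : Matching n}
    (hμ : Stable M μ) {x y : User n} (hxy : x ≠ y) (hy : μ.partner x ≠ y)
    (h1 : dist M.1 x y = dist M.1 x (μ.partner x))
    (h2 : dist M.1 x y < dist M.1 y (μ.partner y)) : Coincidence M x y := by
  have hx : (μ.separate y).partner x = μ.partner x := by
    refine μ.separate_partner_of_ne hxy ?_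
    rintro rfl
    exact hy (μ.partner_partner y)
  refine ⟨μ.separate y, hμ.separate_stableBelow_of_lt h2, ?_, ?_⟩
  · rw [hx]; exact hμ.partner_ne x
  · rw [hx, h1]

/-- Take `y` to be the partner of `x` in one stable matching and `z` the partner of `y` in the
other. All stable matchings share the distances at `x` and at `y`. -/
lemma exists_doubleCoincidence {n k : ℕ} {M : Market n k} {x : User n}
    (h : ∃ y y', y ≠ y' ∧ StablePartner M x y ∧ StablePartner M x y') :
    ∃ y z, DoubleCoincidence M x y z := by
  obtain ⟨y', y, hne, ⟨-, μ, hμ, rfl⟩, ⟨hyx, ν, hν, rfl⟩⟩ := h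
  have hd := hμ.dist_eq hν
  refine ⟨_, _, hμ.doubleCoincidence hyx.symm hne (hd x) ?_⟩
  have := hd (ν.partner x)
  rw [ν.partner_partner] at this
  rw [dist_comm, ← this, dist_comm]

/-- If two matchings are stable for different tie-breaking lists and differ, then some distances
coincide. -/
lemma Stable.exists_coincidence {n k : ℕ} {a : Profiles n k} {T T' : TieBreaks n}
    {μ ν : Matching n} (hμ : Stable (a, T) μ) (hν : Stable (a, T') ν) (hne : ν ≠ μ) :
    (∃ x y, Coincidence (a, T) x y) ∨ ∃ x y z, DoubleCoincidence (a, T) x y z := by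
  let P : ℕ → Prop := fun d => ∃ x, μ.partner x ≠ ν.partner x ∧
    (dist a x (μ.partner x) = d ∨ dist a x (ν.partner x) = d)
  have hP : ∃ d, P d := by
    obtain ⟨x, hx⟩ : ∃ x, μ.partner x ≠ ν.partner x := by
      by_contra! h
      exact hne (Matching.ext (funext fun x => (h x).symm))
    exact ⟨_, x, hx, Or.inl rfl⟩
  classical
  -- The least distance at which the two matchings disagree.
  obtain ⟨d, hd, hmin⟩ : ∃ d, P d ∧ ∀ x, μ.partner x ≠ ν.partner x →
      d ≤ dist a x (μ.partner x) ∧ d ≤ dist a x (ν.partner x) :=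
    ⟨Nat.find hP, Nat.find_spec hP, fun x hx => ⟨Nat.find_min' hP ⟨x, hx, Or.inl rfl⟩,
      Nat.find_min' hP ⟨x, hx, Or.inr rfl⟩⟩⟩
  -- whenever one matching pairs `x` at distance `d`, the other one pairs `x` or its partner so
  have step : ∀ {T : TieBreaks n} {μ ν : Matching n}, Stable (a, T) ν → (∀ x, μ.partner x ≠ x) →
      (∀ x, μ.partner x ≠ ν.partner x → d ≤ dist a x (ν.partner x)) →
      ∀ x, μ.partner x ≠ ν.partner x → dist a x (μ.partner x) = d →
      ∃ x, μ.partner x ≠ ν.partner x ∧ dist a x (μ.partner x) = d ∧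
        dist a x (ν.partner x) = d := by
    intro T μ ν hν hμ hmin x hx hxd
    have hx' : μ.partner (μ.partner x) ≠ ν.partner (μ.partner x) := by
      rw [μ.partner_partner]
      intro h
      apply hx
      have := congrArg ν.partner h
      rw [ν.partner_partner] at this
      exact this.symm
    by_contra! hcon
    have h1 := lt_of_le_of_ne (hmin x hx) (hcon x hx hxd).symm
    have h2 := lt_of_le_of_ne (hmin _ hx') (hcon _ hx' (by
      rw [μ.partner_partner, dist_comm, hxd])).symm
    -- Both would be strictly closer to each other than to their partners under `ν`, so they block
    -- whatever the tie-breaking lists.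
    refine hν x (μ.partner x) ⟨μ.opposite (hμ x), prefers_of_dist_lt ?_, prefers_of_dist_lt ?_⟩
    · exact hxd.trans_lt h1
    · change dist a (μ.partner x) x < _
      rw [dist_comm, hxd]
      exact h2
  obtain ⟨x, hx, hx1, hx2⟩ : ∃ x, μ.partner x ≠ ν.partner x ∧ dist a x (μ.partner x) = d ∧
      dist a x (ν.partner x) = d := by
    obtain ⟨x, hx, hxd | hxd⟩ := hd
    · exact step hν hμ.partner_ne (fun x hx => (hmin x hx).2) x hx hxd
    · obtain ⟨x, h1, h2, h3⟩ := step hμ hν.partner_ne (fun x hx => (hmin x hx.symm).1) x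
        hx.symm hxd
      exact ⟨x, h1.symm, h3, h2⟩
  have hxy := (hν.partner_ne x).symm
  have hd1 : dist a x (ν.partner x) = dist a x (μ.partner x) := hx2.trans hx1.symm
  have hy : μ.partner (ν.partner x) ≠ ν.partner (ν.partner x) := by
    rw [ν.partner_partner]
    intro h
    apply hx
    rw [← h, μ.partner_partner, h]
  -- With `y = ν.partner x`: if the partner of `y` under `μ` is also at distance `d`, the couple is
  -- removed; if it is farther, removing `y` alone keeps stability below `d`.
  rcases (hmin _ hy).1.eq_or_lt with h | h
  · refine Or.inr ⟨_, _, _, hμ.doubleCoincidence hxy hx hd1 ?_⟩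
    change dist a _ _ = dist a _ _
    rw [dist_comm, ← h, hx2]
  · exact Or.inl ⟨_, _, hμ.coincidence hxy hx hd1 (hx2.trans_lt h)⟩

/-- Excluding coincidences for one `T` suffices, since the reference matching `μ` is stable for `T`
while its competitor may use any lists. -/
lemma uniqueWithoutTieBreaking {n k : ℕ} {a : Profiles n k} (T : TieBreaks n)
    (h1 : ∀ x y, ¬ Coincidence (a, T) x y) (h2 : ∀ x y z, ¬ DoubleCoincidence (a, T) x y z) :
    UniqueWithoutTieBreaking a := by
  obtain ⟨μ, hμ⟩ := exists_stable (a, T)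
  have huniq : ∀ (T' : TieBreaks n) (ν : Matching n), Stable (a, T') ν → ν = μ := by
    intro T' ν hν
    by_contra hne
    rcases hμ.exists_coincidence hν hne with ⟨x, y, h⟩ | ⟨x, y, z, h⟩
    · exact h1 x y h
    · exact h2 x y z h
  refine ⟨μ, fun T' ν => ⟨huniq T' ν, ?_⟩⟩
  rintro rfl
  obtain ⟨ν', hν'⟩ := exists_stable (a, T')
  rwa [← huniq T' ν' hν']

/-! ### Uniform probability on finite types -/

lemma prob_eq_card_div {α : Type} [Fintype α] [Nonempty α] (p : α → Prop) [DecidablePred p] :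
    prob {x | p x} = (Finset.univ.filter p).card / Fintype.card α := by
  classical
  rw [prob, PMF.toOuterMeasure_uniformOfFintype_apply, ENNReal.toReal_div]
  simp [Fintype.card_subtype]

open Classical in
lemma prob_eq {α : Type} [Fintype α] [Nonempty α] (E : Set α) :
    prob E = (∑ x, if x ∈ E then (1 : ℝ) else 0) / Fintype.card α := by
  rw [Finset.sum_boole]
  exact prob_eq_card_div (· ∈ E)

lemma prob_nonneg {α : Type} [Fintype α] [Nonempty α] (E : Set α) : 0 ≤ prob E :=
  ENNReal.toReal_nonneg

lemma prob_mono {α : Type} [Fintype α] [Nonempty α] {E F : Set α} (h : E ⊆ F) :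
    prob E ≤ prob F := by
  classical
  rw [prob_eq, prob_eq]
  gcongr with x
  split_ifs with h1 h2 <;> first | exact absurd (h h1) h2 | norm_num

lemma prob_univ {α : Type} [Fintype α] [Nonempty α] : prob (Set.univ : Set α) = 1 := by
  rw [prob_eq]
  simp

lemma prob_le_one {α : Type} [Fintype α] [Nonempty α] (E : Set α) : prob E ≤ 1 :=
  (prob_mono (Set.subset_univ E)).trans_eq prob_univ

lemma prob_union_le {α : Type} [Fintype α] [Nonempty α] (E F : Set α) :
    prob (E ∪ F) ≤ prob E + prob F := by
  classical
  rw [prob_eq, prob_eq, prob_eq, ← add_div, ← Finset.sum_add_distrib]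
  gcongr with x
  by_cases h1 : x ∈ E <;> by_cases h2 : x ∈ F <;> simp [h1, h2]

lemma prob_exists_le {α ι : Type} [Fintype α] [Nonempty α] [Fintype ι] (P : ι → α → Prop) :
    prob {x | ∃ i, P i x} ≤ ∑ i, prob {x | P i x} := by
  classical
  simp only [prob_eq]
  rw [← Finset.sum_div, Finset.sum_comm]
  gcongr with x
  split_ifs with h
  · obtain ⟨i, hi⟩ := h
    calc (1 : ℝ) = if x ∈ {x | P i x} then 1 else 0 := (if_pos hi).symm
      _ ≤ _ := Finset.single_le_sum (f := fun i => if x ∈ {x | P i x} then (1 : ℝ) else 0)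
        (fun j _ => by positivity) (Finset.mem_univ i)
  · positivity

/-- A union bound with a uniform estimate. -/
lemma prob_exists_le_card_mul {α ι : Type} [Fintype α] [Nonempty α] [Fintype ι]
    {P : ι → α → Prop} {c : ℝ} (h : ∀ i, prob {x | P i x} ≤ c) :
    prob {x | ∃ i, P i x} ≤ Fintype.card ι * c := by
  refine (prob_exists_le P).trans ((Finset.sum_le_sum fun i _ => h i).trans_eq ?_)
  simp

lemma prob_prod_le {α β : Type} [Fintype α] [Nonempty α] [Fintype β] [Nonempty β]
    {P : α × β → Prop} {c : ℝ} (h : ∀ t, prob {x | P (x, t)} ≤ c) : prob {p | P p} ≤ c := by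
  classical
  simp only [prob_eq] at h ⊢
  have hα : (0 : ℝ) < Fintype.card α := by exact_mod_cast Fintype.card_pos
  have hβ : (0 : ℝ) < Fintype.card β := by exact_mod_cast Fintype.card_pos
  rw [Fintype.sum_prod_type_right, Fintype.card_prod, Nat.cast_mul, div_le_iff₀ (by positivity)]
  calc _ ≤ ∑ _t : β, c * Fintype.card α := Finset.sum_le_sum fun t _ => (div_le_iff₀ hα).1 (h t)
    _ = _ := by simp; ring

/-- Swapping coordinate `i` with the fresh value is an involution: resampling one coordinate
preserves the uniform distribution. -/
lemma sum_update {ι K : Type} [Fintype ι] [DecidableEq ι] [Fintype K] (i : ι)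
    (f : (ι → K) → ℝ) :
    ∑ a, ∑ b, f (Function.update a i b) = Fintype.card K * ∑ a, f a := by
  have hinv : Function.Involutive
      (fun p : (ι → K) × K => (Function.update p.1 i p.2, p.1 i)) := by
    rintro ⟨a, b⟩
    simp
  rw [← Fintype.sum_prod_type' (f := fun a b => f (Function.update a i b)),
    ← Equiv.sum_comp hinv.toPerm, Fintype.sum_prod_type, Finset.mul_sum]
  simp

/-- If, conditionally on all other coordinates, the event `P` has probability at most `δ`, and it
requires an event `Q` that does not depend on the coordinate `i`, then `P` has probability at most
`δ` times that of `Q`. -/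
lemma prob_le_mul_of_update {ι K : Type} [Fintype ι] [DecidableEq ι] [Fintype K] [Nonempty K]
    (i : ι) {P Q : (ι → K) → Prop} {δ : ℝ} (hPQ : ∀ a b, P (Function.update a i b) → Q a)
    (h : ∀ a, prob {b | P (Function.update a i b)} ≤ δ) :
    prob {a | P a} ≤ δ * prob {a | Q a} := by
  classical
  have hK : (0 : ℝ) < Fintype.card K := by exact_mod_cast Fintype.card_pos
  have key : ∑ a, ∑ b, (if P (Function.update a i b) then (1 : ℝ) else 0) ≤
      ∑ a, δ * Fintype.card K * if Q a then 1 else 0 := by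
    refine Finset.sum_le_sum fun a _ => ?_
    by_cases hQ : Q a
    · have := h a
      rw [prob_eq, div_le_iff₀ hK] at this
      simpa [hQ] using this
    · have : ∀ b, ¬ P (Function.update a i b) := fun b hb => hQ (hPQ a b hb)
      simp [hQ, this]
  rw [sum_update i fun a => if P a then (1 : ℝ) else 0, ← Finset.mul_sum] at key
  rw [prob_eq, prob_eq, ← mul_div_assoc]
  gcongr
  simp only [Set.mem_ofPred_eq]
  refine le_of_mul_le_mul_left ?_ hK
  linarith

/-- Markov's inequality for the fraction of the indices for which an event happens. -/
lemma prob_lt_ncard_div_le {α ι : Type} [Fintype α] [Nonempty α] [Fintype ι]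
    (R : α → ι → Prop) {N ε : ℝ} (hN : 0 < N) (hε : 0 < ε) :
    prob {a | ε < ((Set.ncard {x | R a x} : ℕ) : ℝ) / N} ≤
      (∑ x, prob {a | R a x}) / (N * ε) := by
  classical
  simp only [prob_eq]
  rw [← Finset.sum_div, Finset.sum_comm, div_right_comm, Finset.sum_div _ _ (N * ε)]
  gcongr with a
  have hcard : ∑ x, (if a ∈ {a | R a x} then (1 : ℝ) else 0) = (Set.ncard {x | R a x} : ℕ) := by
    rw [Finset.sum_boole, Set.ncard_eq_toFinset_card']
    congr 2
    ext x
    simp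
  rw [hcard]
  split_ifs with h
  · rw [Set.mem_ofPred_eq, lt_div_iff₀ hN] at h
    rw [le_div_iff₀ (by positivity)]
    linarith
  · positivity

/-! ### Hamming distance to a random profile -/

lemma sq_centralBinom_mul_le (m : ℕ) : m.centralBinom ^ 2 * (2 * m + 1) ≤ 16 ^ m := by
  induction m with
  | zero => simp
  | succ m ih =>
    have h := Nat.succ_mul_centralBinom_succ m
    have h2 : ((m + 1) * (m + 1).centralBinom) ^ 2 * (2 * (m + 1) + 1) ≤
        (m + 1) ^ 2 * 16 ^ (m + 1) := by
      rw [h]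
      calc (2 * (2 * m + 1) * m.centralBinom) ^ 2 * (2 * (m + 1) + 1)
          = m.centralBinom ^ 2 * (2 * m + 1) * (4 * ((2 * m + 1) * (2 * m + 3))) := by ring
        _ ≤ 16 ^ m * (4 * (4 * (m + 1) ^ 2)) := by
            refine Nat.mul_le_mul ih (Nat.mul_le_mul_left 4 ?_)
            -- The induction rests on `(2m + 1)(2m + 3) ≤ 4(m + 1)²`.
            nlinarith
        _ = _ := by ring
    rw [mul_pow, mul_assoc] at h2
    exact Nat.le_of_mul_le_mul_left h2 (by positivity)

lemma sq_choose_mul_le (k d : ℕ) : k.choose d ^ 2 * (k + 1) ≤ 4 ^ k := by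
  have hle : k.choose d ^ 2 * (k + 1) ≤ k.choose (k / 2) ^ 2 * (k + 1) := by
    gcongr
    exact Nat.choose_le_middle d k
  refine hle.trans ?_
  obtain ⟨m, rfl | rfl⟩ := Nat.even_or_odd' k
  · have := sq_centralBinom_mul_le m
    rw [Nat.mul_div_cancel_left m two_pos, pow_mul]
    exact this
  · have h := sq_centralBinom_mul_le (m + 1)
    -- For odd `k` the middle coefficient is half of the next central one.
    have h2 : (m + 1).centralBinom = 2 * (2 * m + 1).choose m := by
      rw [Nat.centralBinom_eq_two_mul_choose, show 2 * (m + 1) = 2 * m + 1 + 1 by ring,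
        Nat.choose_succ_succ, Nat.choose_symm_half]
      ring
    rw [show (2 * m + 1) / 2 = m by omega]
    rw [h2] at h
    have h3 : 4 * 4 ^ (2 * m + 1) = 16 ^ (m + 1) := by
      rw [← pow_succ', show 2 * m + 1 + 1 = 2 * (m + 1) by ring, pow_mul]
      norm_num
    nlinarith [Nat.zero_le ((2 * m + 1).choose m ^ 2)]

lemma card_hammingDist_eq_le {k : ℕ} (c : Fin k → Bool) (d : ℕ) :
    (Finset.univ.filter fun b => hammingDist c b = d).card ≤ k.choose d := by
  calc _ ≤ (Finset.powersetCard d (Finset.univ : Finset (Fin k))).card := by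
        refine Finset.card_le_card_of_injOn (fun b => Finset.univ.filter fun i => c i ≠ b i) ?_ ?_
        · intro b hb
          simpa [Finset.mem_powersetCard, hammingDist] using hb
        · intro b _ b' _ h
          funext i
          have := congrArg (i ∈ ·) h
          simp only [Finset.mem_filter, Finset.mem_univ, true_and] at this
          revert this
          cases c i <;> cases b i <;> cases b' i <;> simp
    _ = _ := by simp

/-- No value of the distance to a random profile is likely. -/
lemma prob_hammingDist_eq_le {k : ℕ} (c : Fin k → Bool) (d : ℕ) :
    prob {b | hammingDist c b = d} ≤ 1 / √(k + 1) := by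
  classical
  have h1 : (0 : ℝ) < √(k + 1) := Real.sqrt_pos.2 (by positivity)
  rw [prob_eq_card_div, div_le_div_iff₀ (by simp) h1, one_mul]
  simp only [Fintype.card_fun, Fintype.card_bool,
    Fintype.card_fin, Nat.cast_pow, Nat.cast_ofNat]
  have h2 : ((k.choose d : ℝ) * √(k + 1)) ^ 2 ≤ (2 ^ k) ^ 2 := by
    rw [mul_pow, Real.sq_sqrt (by positivity), ← pow_mul, mul_comm k 2, pow_mul]
    norm_num
    exact_mod_cast sq_choose_mul_le k d
  refine le_trans ?_ (le_of_sq_le_sq h2 (by positivity))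
  gcongr
  exact card_hammingDist_eq_le c d

lemma sum_exp_neg_mul_hammingDist {k : ℕ} (c : Fin k → Bool) (l : ℝ) :
    ∑ b, Real.exp (-(l * hammingDist c b)) = (1 + Real.exp (-l)) ^ k := by
  have h : ∀ b : Fin k → Bool, Real.exp (-(l * hammingDist c b)) =
      ∏ i, if c i ≠ b i then Real.exp (-l) else 1 := by
    intro b
    rw [Finset.prod_ite, Finset.prod_const, Finset.prod_const_one, mul_one, hammingDist,
      ← Real.exp_nat_mul]
    congr 1
    ring
  simp only [h]
  rw [← Fintype.prod_sum (fun i b => if c i ≠ b then Real.exp (-l) else 1)]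
  rw [← Fin.prod_const]
  refine Finset.prod_congr rfl fun i _ => ?_
  cases c i <;> simp [add_comm]

/-- Chernoff's bound for the distance to a random profile. -/
lemma prob_hammingDist_lt_le {k : ℕ} (hk : 0 < k) (c : Fin k → Bool) {t : ℝ} (ht : 0 ≤ t) :
    prob {b | (hammingDist c b : ℝ) < k / 2 - t} ≤ Real.exp (-(2 * t ^ 2 / k)) := by
  classical
  have hk' : (0 : ℝ) < k := by exact_mod_cast hk
  -- This minimises the exponent `k * l ^ 2 / 8 - l * t` of the exponential Markov bound.
  set l : ℝ := 4 * t / k with hl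
  have hl0 : 0 ≤ l := by positivity
  have h1 : ∑ b : Fin k → Bool, (if b ∈ {b | (hammingDist c b : ℝ) < k / 2 - t} then (1 : ℝ)
      else 0) ≤ ∑ b, Real.exp (l * (k / 2 - t)) * Real.exp (-(l * hammingDist c b)) := by
    gcongr with b
    split_ifs with h
    · rw [← Real.exp_add]
      refine Real.one_le_exp ?_
      have := mul_le_mul_of_nonneg_left (le_of_lt h) hl0
      linarith
    · positivity
  rw [← Finset.mul_sum, sum_exp_neg_mul_hammingDist] at h1
  have h2 : 1 + Real.exp (-l) ≤ 2 * Real.exp (l ^ 2 / 8 - l / 2) := by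
    have hc := Real.cosh_le_exp_half_sq (l / 2)
    have he : 1 + Real.exp (-l) = 2 * Real.exp (-(l / 2)) * Real.cosh (l / 2) := by
      rw [Real.cosh_eq, mul_comm 2, mul_assoc, mul_div_cancel₀ _ two_ne_zero, mul_add,
        ← Real.exp_add, ← Real.exp_add]
      congr 1
      · simp
      · congr 1; ring
    calc _ = _ := he
      _ ≤ 2 * Real.exp (-(l / 2)) * Real.exp ((l / 2) ^ 2 / 2) := by gcongr
      _ = _ := by
        rw [mul_assoc, ← Real.exp_add]
        congr 2; ring
  rw [prob_eq, div_le_iff₀ (by simp)]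
  calc _ ≤ _ := h1
    _ ≤ Real.exp (l * (k / 2 - t)) * (2 * Real.exp (l ^ 2 / 8 - l / 2)) ^ k := by gcongr
    _ = _ := by
      rw [mul_pow, ← Real.exp_nat_mul, mul_left_comm, ← Real.exp_add, mul_comm]
      simp only [Fintype.card_fun, Fintype.card_bool, Fintype.card_fin, Nat.cast_pow,
        Nat.cast_ofNat]
      congr 2
      rw [hl]
      field_simp
      ring

/-! ### Probabilities of coincidences -/

lemma prob_coincidence_le {n k : ℕ} (x y : User n) :
    prob {M : Market n k | Coincidence M x y} ≤ 1 / √(k + 1) := by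
  refine prob_prod_le (P := fun M : Market n k => Coincidence M x y) fun T => ?_
  refine (prob_le_mul_of_update y (Q := fun _ => True) (δ := 1 / √(k + 1)) (fun _ _ _ => trivial)
    fun a => ?_).trans ?_
  -- One good profile `b₀` of `y` fixes the critical distance of `x`, so every good `b` lies on a
  -- single sphere around `a x`.
  · by_cases h : ∃ b, Coincidence (Function.update a y b, T) x y
    · obtain ⟨b₀, hb₀⟩ := h
      have hxy : x ≠ y := hb₀.mem
      refine le_trans (prob_mono ?_)
        (prob_hammingDist_eq_le (a x) (dist (Function.update a y b₀) x y))
      intro b hb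
      have hb' : Critical (Function.update a y b₀, T) {y}ᶜ x (dist (Function.update a y b) x y) :=
        Critical.congr (fun z hz => by
          rw [Function.update_of_ne hz, Function.update_of_ne hz]) hb
      have := hb'.unique hb₀
      change hammingDist (a x) b = _
      rw [← this, dist, Function.update_of_ne hxy, Function.update_self]
    · refine le_trans (prob_mono (F := ∅) ?_) ?_
      · intro b hb
        exact absurd ⟨b, hb⟩ h
      · rw [prob_eq]
        simp only [Set.mem_empty_iff_false, if_false, Finset.sum_const_zero, zero_div]
        positivity
  · exact mul_le_of_le_one_right (by positivity) (prob_le_one _)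

lemma prob_doubleCoincidence_le {n k : ℕ} (x y z : User n) :
    prob {M : Market n k | DoubleCoincidence M x y z} ≤ 1 / (k + 1) := by
  refine prob_prod_le (P := fun M : Market n k => DoubleCoincidence M x y z) fun T => ?_
  -- The part of the event that does not involve the profile of `z`. Resampling `y` bounds `Q`;
  -- resampling `z` then gives the second factor.
  let Q : Profiles n k → Prop := fun a =>
    z ≠ y ∧ x ≠ y ∧ x ≠ z ∧ Critical (a, T) {y, z}ᶜ x (dist a x y)
  have hQ : prob {a | Q a} ≤ 1 / √(k + 1) := by
    refine (prob_le_mul_of_update y (Q := fun _ => True) (δ := 1 / √(k + 1))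
      (fun _ _ _ => trivial) fun a => ?_).trans ?_
    · by_cases h : ∃ b, Q (Function.update a y b)
      · obtain ⟨b₀, hzy, hxy, hxz, hb₀⟩ := h
        refine le_trans (prob_mono ?_)
          (prob_hammingDist_eq_le (a x) (dist (Function.update a y b₀) x y))
        rintro b ⟨-, -, -, hb⟩
        have hb' : Critical (Function.update a y b₀, T) {y, z}ᶜ x
            (dist (Function.update a y b) x y) :=
          Critical.congr (fun w hw => by
            simp only [Set.mem_compl_iff, Set.mem_insert_iff, not_or] at hw
            rw [Function.update_of_ne hw.1, Function.update_of_ne hw.1]) hb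
        have := hb'.unique hb₀
        change hammingDist (a x) b = _
        rw [← this, dist, Function.update_of_ne hxy, Function.update_self]
      · refine le_trans (prob_mono (F := ∅) ?_) ?_
        · intro b hb
          exact absurd ⟨b, hb⟩ h
        · rw [prob_eq]
          simp only [Set.mem_empty_iff_false, if_false, Finset.sum_const_zero, zero_div]
          positivity
    · exact mul_le_of_le_one_right (by positivity) (prob_le_one _)
  refine (prob_le_mul_of_update z (Q := Q) (δ := 1 / √(k + 1)) ?_ fun a => ?_).trans ?_
  · rintro a b ⟨h1, hzy, -⟩
    have hx := h1.mem
    simp only [Set.mem_compl_iff, Set.mem_insert_iff, Set.mem_singleton_iff, not_or] at hx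
    have hd : dist (Function.update a z b) x y = dist a x y := by
      rw [dist, dist, Function.update_of_ne hx.2, Function.update_of_ne hzy.symm]
    refine ⟨hzy, hx.1, hx.2, Critical.congr (fun w hw => ?_) (hd ▸ h1)⟩
    simp only [Set.mem_compl_iff, Set.mem_insert_iff, Set.mem_singleton_iff, not_or] at hw
    rw [Function.update_of_ne hw.2]
  · refine le_trans (prob_mono ?_) (prob_hammingDist_eq_le (a y) (dist a x y))
    rintro b ⟨h1, hzy, h2⟩
    have hx := h1.mem
    simp only [Set.mem_compl_iff, Set.mem_insert_iff, Set.mem_singleton_iff, not_or] at hx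
    simp only [dist, Function.update_self, Function.update_of_ne hx.2,
      Function.update_of_ne hzy.symm] at h2
    rw [Set.mem_ofPred_eq, hammingDist_comm, h2, dist]
  · calc _ ≤ 1 / √((k : ℝ) + 1) * (1 / √(k + 1)) := by gcongr
      _ = 1 / (k + 1) := by
        rw [div_mul_div_comm, one_mul, Real.mul_self_sqrt (by positivity)]

lemma prob_exists_doubleCoincidence_le {n k : ℕ} (x : User n) :
    prob {M : Market n k | ∃ y z, DoubleCoincidence M x y z} ≤ (2 * n) ^ 2 / (k + 1) := by
  refine (prob_exists_le_card_mul fun y => prob_exists_le_card_mul fun z =>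
    prob_doubleCoincidence_le x y z).trans_eq ?_
  simp only [Fintype.card_sum, Fintype.card_fin, Nat.cast_add]
  ring

lemma prob_multipleFraction_le {n k : ℕ} (hn : 0 < n) {ε : ℝ} (hε : 0 < ε) :
    prob {M : Market n k | ε < multipleFraction M} ≤ (2 * n) ^ 2 / (k + 1) / ε := by
  have hn' : (0 : ℝ) < 2 * n := by positivity
  refine (prob_lt_ncard_div_le (fun (M : Market n k) (x : User n) =>
    ∃ y y', y ≠ y' ∧ StablePartner M x y ∧ StablePartner M x y') hn' hε).trans ?_
  rw [mul_comm (2 * (n : ℝ)) ε, ← div_div, div_le_iff₀ hn', div_mul_eq_mul_div]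
  gcongr
  calc _ ≤ ∑ _x : User n, ((2 * n) ^ 2 / (k + 1) : ℝ) := Finset.sum_le_sum fun x _ =>
        (prob_mono fun M hM => exists_doubleCoincidence hM).trans
          (prob_exists_doubleCoincidence_le x)
    _ = _ := by
        simp only [Finset.sum_const, Finset.card_univ, Fintype.card_sum, Fintype.card_fin,
          nsmul_eq_mul, Nat.cast_add]
        ring

lemma one_sub_le_prob_uniqueWithoutTieBreaking {n k : ℕ} :
    1 - ((2 * n) ^ 2 / √(k + 1) + (2 * n) ^ 3 / (k + 1) : ℝ) ≤
      prob {M : Market n k | UniqueWithoutTieBreaking M.1} := by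
  have h1 : prob {M : Market n k | ∃ x y, Coincidence M x y} ≤ (2 * n) ^ 2 / √(k + 1) := by
    refine (prob_exists_le_card_mul fun x => prob_exists_le_card_mul fun y =>
      prob_coincidence_le x y).trans_eq ?_
    simp only [Fintype.card_sum, Fintype.card_fin, Nat.cast_add]
    ring
  have h2 : prob {M : Market n k | ∃ x y z, DoubleCoincidence M x y z} ≤
      (2 * n) ^ 3 / (k + 1) := by
    refine (prob_exists_le_card_mul fun x => prob_exists_doubleCoincidence_le x).trans_eq ?_
    simp only [Fintype.card_sum, Fintype.card_fin, Nat.cast_add]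
    ring
  have h3 : (Set.univ : Set (Market n k)) ⊆ {M | UniqueWithoutTieBreaking M.1} ∪
      ({M | ∃ x y, Coincidence M x y} ∪ {M | ∃ x y z, DoubleCoincidence M x y z}) := by
    rintro M -
    by_contra h
    simp only [Set.mem_union, Set.mem_ofPred_eq, not_or, not_exists] at h
    exact h.1 (uniqueWithoutTieBreaking M.2 h.2.1 h.2.2)
  have h4 := (prob_mono h3).trans ((prob_union_le _ _).trans
    (add_le_add_right (prob_union_le _ _) _))
  rw [prob_univ] at h4
  linarith

/-! ### Lower tail of the matching distance -/

lemma prob_dist_lt_le {n k : ℕ} (hk : 0 < k) {x y : User n} (hxy : y ≠ x) {t : ℝ} (ht : 0 ≤ t) :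
    prob {a : Profiles n k | (dist a x y : ℝ) < k / 2 - t} ≤ Real.exp (-(2 * t ^ 2 / k)) := by
  refine (prob_le_mul_of_update y (Q := fun _ => True) (fun _ _ _ => trivial) fun a => ?_).trans
    (mul_le_of_le_one_right (Real.exp_pos _).le (prob_le_one _))
  simp only [dist, Function.update_self, Function.update_of_ne hxy.symm]
  exact prob_hammingDist_lt_le hk (a x) ht

lemma prob_matchingDist_lt_le {n k : ℕ} [NeZero n] {β : ℝ} (hβ : 1 < β) :
    prob {p : Market n k × User n |
      (matchingDist p.1 p.2 : ℝ) < (k : ℝ) / 2 - √(β * k * Real.log n)} ≤ (n : ℝ) ^ (1 - β) := by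
  have hn1 : (1 : ℝ) ≤ n := by exact_mod_cast NeZero.one_le
  have hlog : 0 ≤ Real.log n := Real.log_nonneg hn1
  have hβ0 : 0 ≤ β := by linarith
  -- For `k = 0` the event asks for a negative distance; Chernoff's bound needs `k > 0`.
  rcases Nat.eq_zero_or_pos k with rfl | hk
  · refine le_trans (prob_mono (F := ∅) ?_) ?_
    · intro p hp
      have h0 : (0 : ℝ) ≤ matchingDist p.1 p.2 := Nat.cast_nonneg _
      simp only [Set.mem_ofPred_eq, Nat.cast_zero, mul_zero, zero_mul, Real.sqrt_zero, zero_div,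
        sub_zero] at hp
      exact absurd hp (not_lt.2 h0)
    · rw [prob_eq]
      simp only [Set.mem_empty_iff_false, if_false, Finset.sum_const_zero, zero_div]
      positivity
  have hk' : (0 : ℝ) < k := by exact_mod_cast hk
  set t := √(β * k * Real.log n) with ht
  have hsq : t ^ 2 = β * k * Real.log n := Real.sq_sqrt (by positivity)
  have hexp : Real.exp (-(2 * t ^ 2 / k)) = (n : ℝ) ^ (-(2 * β)) := by
    rw [Real.rpow_def_of_pos (by linarith), hsq]
    congr 1
    field_simp
  refine prob_prod_le (P := fun p : Market n k × User n =>
    (matchingDist p.1 p.2 : ℝ) < (k : ℝ) / 2 - t) fun x => ?_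
  -- A small matching distance requires a close member of the opposite side, one of `n` candidates.
  have hsub : {M : Market n k | (matchingDist M x : ℝ) < (k : ℝ) / 2 - t} ⊆
      {M | ∃ i, (dist M.1 x (across x i) : ℝ) < (k : ℝ) / 2 - t} := by
    intro M hM
    obtain ⟨μ, hμ⟩ := exists_stable M
    refine ⟨idx (μ.partner x), ?_⟩
    rw [(μ.opposite (hμ.partner_ne x)).across_idx, hμ.dist_eq_matchingDist]
    exact hM
  refine (prob_mono hsub).trans ((prob_exists_le_card_mul fun i => prob_prod_le
    (P := fun M : Market n k => (dist M.1 x (across x i) : ℝ) < (k : ℝ) / 2 - t) fun _ =>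
    prob_dist_lt_le hk (opposite_across x i).ne (Real.sqrt_nonneg _)).trans ?_)
  rw [hexp, Fintype.card_fin]
  calc (n : ℝ) * (n : ℝ) ^ (-(2 * β)) = (n : ℝ) ^ (1 - 2 * β) := by
        rw [sub_eq_add_neg, Real.rpow_add (by linarith), Real.rpow_one]
    _ ≤ (n : ℝ) ^ (1 - β) := Real.rpow_le_rpow_of_exponent_le hn1 (by linarith)

/-! ### Asymptotics -/

lemma tendsto_prob_multipleFraction {k : ℕ → ℕ}
    (hk : (fun n : ℕ => (n : ℝ) ^ 3) =O[atTop] (fun n : ℕ => (k n : ℝ))) {ε : ℝ} (hε : 0 < ε) :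
    Tendsto (fun n : ℕ => prob {M : Market n (k n) | ε < multipleFraction M}) atTop (𝓝 0) := by
  obtain ⟨C, hC, hCk⟩ := hk.exists_pos
  refine squeeze_zero' (Eventually.of_forall fun n => prob_nonneg _) ?_
    (tendsto_const_div_atTop_nhds_zero_nat (4 * C / ε))
  filter_upwards [hCk.bound, eventually_gt_atTop 0] with n hn hpos
  have hpos' : (0 : ℝ) < n := by exact_mod_cast hpos
  rw [Real.norm_of_nonneg (by positivity), Real.norm_of_nonneg (by positivity)] at hn
  refine (prob_multipleFraction_le hpos hε).trans ?_
  rw [div_right_comm (4 * C) ε]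
  refine div_le_div_of_nonneg_right ?_ hε.le
  rw [div_le_div_iff₀ (by positivity) hpos']
  nlinarith

lemma tendsto_prob_uniqueWithoutTieBreaking {k : ℕ → ℕ}
    (hk : (fun n : ℕ => (n : ℝ) ^ 6) =O[atTop] (fun n : ℕ => (k n : ℝ))) :
    Tendsto (fun n : ℕ => prob {M : Market n (k n) | UniqueWithoutTieBreaking M.1})
      atTop (𝓝 1) := by
  obtain ⟨C, hC, hCk⟩ := hk.exists_pos
  have hlim : Tendsto (fun n : ℕ => 1 - (4 * √C + 8 * C) / (n : ℝ)) atTop (𝓝 1) := by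
    simpa using (tendsto_const_div_atTop_nhds_zero_nat (4 * √C + 8 * C)).const_sub 1
  refine tendsto_of_tendsto_of_tendsto_of_le_of_le' hlim tendsto_const_nhds ?_
    (Eventually.of_forall fun n => prob_le_one _)
  filter_upwards [hCk.bound, eventually_gt_atTop 0] with n hn hpos
  have hpos' : (1 : ℝ) ≤ n := by exact_mod_cast hpos
  rw [Real.norm_of_nonneg (by positivity), Real.norm_of_nonneg (by positivity)] at hn
  have hn1 : (n : ℝ) ^ 6 ≤ C * (k n + 1) := by nlinarith
  refine le_trans ?_ one_sub_le_prob_uniqueWithoutTieBreaking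
  have h1 : (2 * n : ℝ) ^ 2 / √(k n + 1) ≤ 4 * √C / n := by
    rw [div_le_div_iff₀ (Real.sqrt_pos.2 (by positivity)) (by linarith), mul_assoc 4,
      ← Real.sqrt_mul hC.le]
    -- The exponent `6` is used here: the single coincidences cost `n ^ 2 / √k`, which has to be
    -- `O(1 / n)`.
    have : (n : ℝ) ^ 3 ≤ √(C * (k n + 1)) := Real.le_sqrt_of_sq_le (by rw [← pow_mul]; exact hn1)
    nlinarith
  have h2 : (2 * n : ℝ) ^ 3 / (k n + 1) ≤ 8 * C / n := by
    rw [div_le_div_iff₀ (by positivity) (by linarith)]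
    have : (n : ℝ) ^ 4 ≤ (n : ℝ) ^ 6 := pow_le_pow_right₀ hpos' (by norm_num)
    nlinarith
  rw [add_div]
  linarith

end ProfileMatching

open ProfileMatching in
theorem theorem3p3 :
    -- (i) few participants have several stable partners
    (∀ k : ℕ → ℕ, (fun n : ℕ => (n : ℝ) ^ 3) =O[atTop] (fun n : ℕ => (k n : ℝ)) →
      ∀ ε : ℝ, 0 < ε →
        Tendsto (fun n : ℕ => prob {M : Market n (k n) | ε < multipleFraction M}) atTop (𝓝 0)) ∧
    -- (ii) uniqueness without tie-breaking
    (∀ k : ℕ → ℕ, (fun n : ℕ => (n : ℝ) ^ 6) =O[atTop] (fun n : ℕ => (k n : ℝ)) →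
      Tendsto (fun n : ℕ => prob {M : Market n (k n) | UniqueWithoutTieBreaking M.1})
        atTop (𝓝 1)) ∧
    -- the matching distance, which (iii) is about, is well defined
    (∀ (n k : ℕ) (M : Market n k), (∃ μ : Matching n, Stable M μ) ∧
      ∀ μ : Matching n, Stable M μ → ∀ x : User n, dist M.1 x (μ.partner x) = matchingDist M x) ∧
    -- (iii) lower tail of the matching distance `X` of a uniformly random participant
    (∀ (n k : ℕ) [NeZero n] (β : ℝ), 1 < β →
      prob {p : Market n k × User n |
          (matchingDist p.1 p.2 : ℝ) < (k : ℝ) / 2 - Real.sqrt (β * k * Real.log n)} ≤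
        (n : ℝ) ^ (1 - β)) := by
  exact ⟨fun k hk ε hε => tendsto_prob_multipleFraction hk hε,
    fun k hk => tendsto_prob_uniqueWithoutTieBreaking hk,
    fun n k M => ⟨exists_stable M, fun μ hμ x => hμ.dist_eq_matchingDist x⟩,
    fun n k _ β hβ => prob_matchingDist_lt_le hβ⟩
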